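/- Let $\mathcal{E}$ be an exact category (in the sense of Quillen): an additive category with a class of kernel–cokernel pairs $X\rightarrowtail Y\twoheadrightarrow Z$, called conflations, closed under isomorphism, such that, calling their first maps inflations and their second maps deflations, every map $X\to 0$ is a deflation, deflations are closed under composition, pullbacks along deflations exist and pullbacks of deflations are deflations, and dually for inflations. A morphism is admissible if it is a deflation followed by an inflation. Let $\Upsilon\colon A\mapsto \operatorname{Hom}_{\mathcal{E}}(-,A)$ be the Yoneda embedding into the abelian category $\operatorname{Mod}(\mathcal{E})$ of additive contravariant functors from $\mathcal{E}$ to abelian groups. Let $\operatorname{mod}_{\mathrm{adm}}(\mathcal{E})$ (respectively $\operatorname{eff}(\mathcal{E})$) be the full subcategory of those functors $F$ for which there is an exact sequence $\Upsilon(X)\xrightarrow{\Upsilon(f)}\Upsilon(Y)\to F\to 0$ with $f$ admissible (respectively, $f$ a deflation). The conflations of $\operatorname{mod}_{\mathrm{adm}}(\mathcal{E})$ are the sequences in it that are short exact in $\operatorname{Mod}(\mathcal{E})$. In a category with conflations, an object $P$ is projective if every morphism $P\to Y$ lifts along every deflation $X\twoheadrightarrow Y$; there are enough projectives if every object $A$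 admits a deflation $P\twoheadrightarrow A$ with $P$ projective; $\operatorname{gen}(\mathcal{X})$ is the class of objects $A$ admitting a deflation $X\twoheadrightarrow A$ with $X\in\mathcal{X}$; ${}^{\perp}\mathcal{X}$ is the class of objects $A$ with $\operatorname{Hom}(A,X)=0$ for all $X\in\mathcal{X}$; and a torsion pair is a pair $(\mathcal{T},\mathcal{F})$ of full subcategories closed under isomorphism such that $\operatorname{Hom}(T,F)=0$ for all $T\in\mathcal{T}$, $F\in\mathcal{F}$, and every object $M$ sits in a conflation $T\rightarrowtail M\twoheadrightarrow F$ with $T\in\mathcal{T}$, $F\in\mathcal{F}$. Let $\mathcal{Q}$ be the full subcategory of projective objects of $\operatorname{mod}_{\mathrm{adm}}(\mathcal{E})$, and form $\operatorname{gen}$ and ${}^{\perp}$ inside $\operatorname{mod}_{\mathrm{adm}}(\mathcal{E})$. The following are equivalent: (1) $\mathcal{E}$ has enough projectives; (2) $(\operatorname{gen}(\mathcal{Q}\cap{}^{\perp}\operatorname{eff}(\mathcal{E})),\operatorname{eff}(\mathcal{E}))$ is a torsion pair in $\operatorname{mod}_{\mathrm{adm}}(\mathcal{E})$; (3) for every $P\in\mathcal{Q}$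 there is a conflation $F'\rightarrowtail P\twoheadrightarrow F''$ in $\operatorname{mod}_{\mathrm{adm}}(\mathcal{E})$ with $F'\in\operatorname{gen}(\mathcal{Q}\cap{}^{\perp}\operatorname{eff}(\mathcal{E}))$ and $F''\in\operatorname{eff}(\mathcal{E})$. -/

import Mathlib

open CategoryTheory CategoryTheory.Limits Opposite

universe v u

/-- A conflation structure on a preadditive category `C`: a chosen class of kernel-cokernel pairs
`X ⟶ Y ⟶ Z`, called conflations, closed under isomorphism. -/
structure ConflationStructure (C : Type u) [Category.{v} C] [Preadditive C] where
  /-- The class of conflations. -/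
  IsConflation : ObjectProperty (ShortComplex C)
  closed_iso : IsConflation.IsClosedUnderIsomorphisms
  isKernel : ∀ S : ShortComplex C, IsConflation S →
    Nonempty (IsLimit (KernelFork.ofι S.f S.zero))
  isCokernel : ∀ S : ShortComplex C, IsConflation S →
    Nonempty (IsColimit (CokernelCofork.ofπ S.g S.zero))

namespace ConflationStructure

section Basic

variable {C : Type u} [Category.{v} C] [Preadditive C] (E : ConflationStructure C)

/-- An inflation is the kernel part of a conflation. -/
def IsInflation {X Y : C} (i : X ⟶ Y) : Prop :=
  ∃ (Z : C) (p : Y ⟶ Z) (w : i ≫ p = 0), E.IsConflation (ShortComplex.mk i p w)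

/-- A deflation is the cokernel part of a conflation. -/
def IsDeflation {Y Z : C} (p : Y ⟶ Z) : Prop :=
  ∃ (X : C) (i : X ⟶ Y) (w : i ≫ p = 0), E.IsConflation (ShortComplex.mk i p w)

/-- A morphism is admissible if it is a deflation followed by an inflation. -/
def IsAdmissible {X Y : C} (f : X ⟶ Y) : Prop :=
  ∃ (I : C) (p : X ⟶ I) (i : I ⟶ Y), E.IsDeflation p ∧ E.IsInflation i ∧ p ≫ i = f

/-- The axioms of a (Quillen) exact category for a conflation structure. -/
structure IsExact : Prop where
  /-- Every morphism to a zero object is a deflation. -/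
  deflation_to_zero : ∀ {X Z : C}, IsZero Z → ∀ p : X ⟶ Z, E.IsDeflation p
  /-- Deflations are closed under composition. -/
  deflation_comp : ∀ {X Y Z : C} (p : X ⟶ Y) (q : Y ⟶ Z),
    E.IsDeflation p → E.IsDeflation q → E.IsDeflation (p ≫ q)
  /-- Pullbacks along deflations exist. -/
  hasPullback : ∀ {X Y Z : C} (p : Y ⟶ Z) (f : X ⟶ Z), E.IsDeflation p → HasPullback f p
  /-- Deflations are stable under pullbacks. -/
  deflation_pullback : ∀ {P X Y Z : C} (p' : P ⟶ X) (f' : P ⟶ Y) (f : X ⟶ Z) (p : Y ⟶ Z),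
    IsPullback p' f' f p → E.IsDeflation p → E.IsDeflation p'
  /-- Every morphism from a zero object is an inflation. -/
  inflation_from_zero : ∀ {Z X : C}, IsZero Z → ∀ i : Z ⟶ X, E.IsInflation i
  /-- Inflations are closed under composition. -/
  inflation_comp : ∀ {X Y Z : C} (i : X ⟶ Y) (j : Y ⟶ Z),
    E.IsInflation i → E.IsInflation j → E.IsInflation (i ≫ j)
  /-- Pushouts along inflations exist. -/
  hasPushout : ∀ {X Y Z : C} (i : X ⟶ Y) (f : X ⟶ Z), E.IsInflation i → HasPushout f i
  /-- Inflations are stable under pushouts. -/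
  inflation_pushout : ∀ {P X Y Z : C} (f : X ⟶ Z) (i : X ⟶ Y) (i' : Z ⟶ P) (f' : Y ⟶ P),
    IsPushout f i i' f' → E.IsInflation i → E.IsInflation i'

/-- The projective objects: those `P` such that every morphism `P ⟶ Y` lifts along every
deflation `X ⟶ Y`. -/
def proj : ObjectProperty C := fun P =>
  ∀ ⦃X Y : C⦄ (p : X ⟶ Y), E.IsDeflation p → ∀ f : P ⟶ Y, ∃ g : P ⟶ X, g ≫ p = f

/-- Every object is the target of a deflation from a projective object. -/
def HasEnoughProj : Prop :=
  ∀ A : C, ∃ (P : C) (p : P ⟶ A), E.proj P ∧ E.IsDeflation p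

/-- `gen 𝒳`: the objects `A` admitting an exact sequence `X ⟶ A ⟶ 0`, i.e. a deflation
`X ⟶ A`, with `X` in `𝒳`. -/
def gen (𝒳 : ObjectProperty C) : ObjectProperty C := fun A =>
  ∃ (X : C) (p : X ⟶ A), 𝒳 X ∧ E.IsDeflation p

/-- A torsion pair `(𝒯, ℱ)`. -/
structure IsTorsionPair (𝒯 ℱ : ObjectProperty C) : Prop where
  closed_iso_left : 𝒯.IsClosedUnderIsomorphisms
  closed_iso_right : ℱ.IsClosedUnderIsomorphisms
  hom_eq_zero : ∀ {T F : C}, 𝒯 T → ℱ F → ∀ f : T ⟶ F, f = 0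
  exists_conflation : ∀ M : C, ∃ (T F : C) (i : T ⟶ M) (p : M ⟶ F) (w : i ≫ p = 0),
    𝒯 T ∧ ℱ F ∧ E.IsConflation (ShortComplex.mk i p w)

/-- There is an exact sequence `Υ(X) ⟶ Υ(Y) ⟶ F ⟶ 0` of contravariant functors from `C` to
abelian groups, whose first map is `Υ(f)`, for the Yoneda embedding `Υ`. -/
def Presents {X Y : C} (f : X ⟶ Y) (F : Cᵒᵖ ⥤ AddCommGrpCat.{v}) : Prop :=
  ∃ (π : preadditiveYoneda.obj Y ⟶ F) (w : preadditiveYoneda.map f ≫ π = 0),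
    (ShortComplex.mk (preadditiveYoneda.map f) π w).Exact ∧ Epi π

/-- The functors presented by an admissible morphism. -/
def smodAdm : ObjectProperty (Cᵒᵖ ⥤ AddCommGrpCat.{v}) := fun F =>
  ∃ (X Y : C) (f : X ⟶ Y), E.IsAdmissible f ∧ Presents f F

/-- The effaceable functors: those presented by a deflation. -/
def eff : ObjectProperty (Cᵒᵖ ⥤ AddCommGrpCat.{v}) := fun F =>
  ∃ (X Y : C) (f : X ⟶ Y), E.IsDeflation f ∧ Presents f F

/-- A functor presented by a morphism between representables is additive. -/
lemma Presents.additive {X Y : C} {f : X ⟶ Y} {F : Cᵒᵖ ⥤ AddCommGrpCat.{v}}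
    (h : Presents f F) : F.Additive := by
  obtain ⟨π, -, -, hπ⟩ := h
  refine ⟨fun {A B} a b => ?_⟩
  rw [← cancel_epi (π.app A), ← π.naturality, Functor.map_add, Preadditive.comp_add,
    Preadditive.add_comp, π.naturality, π.naturality]

variable {E} in
/-- In an exact category every effaceable functor is admissibly presented. -/
lemma IsExact.eff_le_smodAdm [HasZeroObject C] (hE : E.IsExact) : E.eff ≤ E.smodAdm := by
  rintro F ⟨X, Y, f, hf, h⟩
  refine ⟨X, Y, f, ⟨Y, f, 𝟙 Y, hf, ?_, Category.comp_id f⟩, h⟩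
  obtain ⟨Z, hZ⟩ := HasZeroObject.zero (C := C)
  obtain ⟨W, i, w, hc⟩ := hE.deflation_to_zero hZ (0 : Y ⟶ Z)
  refine ⟨Z, 0, comp_zero, ?_⟩
  obtain ⟨hk⟩ := E.isKernel _ hc
  have hi : IsIso i := by
    obtain ⟨l, hl⟩ := KernelFork.IsLimit.lift' hk (𝟙 Y) comp_zero
    have hl' : l ≫ i = 𝟙 Y := hl
    refine ⟨l, Fork.IsLimit.hom_ext hk ?_, hl'⟩
    change (i ≫ l) ≫ i = 𝟙 W ≫ i
    rw [Category.assoc, hl', Category.comp_id, Category.id_comp]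
  have := E.closed_iso
  exact E.IsConflation.prop_of_iso
    (ShortComplex.isoMk (S₁ := ShortComplex.mk i 0 w) (S₂ := ShortComplex.mk (𝟙 Y) 0 comp_zero)
      (asIso i) (Iso.refl _) (Iso.refl _) (by simp) (by simp)) hc

end Basic

section SmodAdm

variable {C : Type u} [Category.{v} C] [Preadditive C] (E : ConflationStructure C)

/-- The category of admissibly presented functors, as a full subcategory of the category of
contravariant functors to abelian groups. -/
abbrev SmodAdm := E.smodAdm.FullSubcategory

/-- The conflations of the category of admissibly presented functors: the sequences that are
short exact as sequences of functors. -/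
def smodAdmConflation : ConflationStructure E.SmodAdm where
  IsConflation := fun S => (S.map E.smodAdm.ι).ShortExact
  closed_iso := ⟨fun e h => ShortComplex.shortExact_of_iso (E.smodAdm.ι.mapShortComplex.mapIso e) h⟩
  isKernel := fun S h => ⟨by
    haveI := h.mono_f
    haveI : Mono S.f := E.smodAdm.ι.mono_of_mono_map h.mono_f
    refine KernelFork.IsLimit.ofι' _ _ fun {A} k hk => ?_
    have hk' : E.smodAdm.ι.map k ≫ (S.map E.smodAdm.ι).g = 0 := by
      change E.smodAdm.ι.map k ≫ E.smodAdm.ι.map S.g = 0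
      rw [← Functor.map_comp, hk, Functor.map_zero]
    let l : E.smodAdm.ι.obj A ⟶ E.smodAdm.ι.obj S.X₁ := h.exact.lift _ hk'
    have hl : l ≫ E.smodAdm.ι.map S.f = E.smodAdm.ι.map k := h.exact.lift_f _ hk'
    refine ⟨E.smodAdm.ι.preimage l, E.smodAdm.ι.map_injective ?_⟩
    rw [Functor.map_comp, Functor.map_preimage, hl]⟩
  isCokernel := fun S h => ⟨by
    haveI := h.epi_g
    haveI : Epi S.g := E.smodAdm.ι.epi_of_epi_map h.epi_g
    refine CokernelCofork.IsColimit.ofπ' _ _ fun {A} k hk => ?_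
    have hk' : (S.map E.smodAdm.ι).f ≫ E.smodAdm.ι.map k = 0 := by
      change E.smodAdm.ι.map S.f ≫ E.smodAdm.ι.map k = 0
      rw [← Functor.map_comp, hk, Functor.map_zero]
    let l : E.smodAdm.ι.obj S.X₃ ⟶ E.smodAdm.ι.obj A := h.exact.desc _ hk'
    have hl : E.smodAdm.ι.map S.g ≫ l = E.smodAdm.ι.map k := h.exact.g_desc _ hk'
    refine ⟨E.smodAdm.ι.preimage l, E.smodAdm.ι.map_injective ?_⟩
    rw [Functor.map_comp, Functor.map_preimage, hl]⟩

/-- The effaceable functors as a full subcategory of the admissibly presented ones. -/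
def effAdm : ObjectProperty E.SmodAdm := E.eff.inverseImage E.smodAdm.ι

end SmodAdm

end ConflationStructure

namespace ConflationStructure

/-! ### Exactness of additive functors tested on representables. -/

section Functors

variable {C : Type u} [Category.{v} C] [Preadditive C]

/-! Given enough projectives, let `f : X ⟶ Y` be an admissible map presenting `M`, and cover `Y` by
a deflation `q : P ⟶ Y` with `P` projective. Split `M` at the image of `Υ(P) ⟶ Υ(Y) ⟶ M`. The image
is presented by the pullback of `f` along `q`, still admissible; the quotient of `M` by it is
presented by `(f, q) : X ⊞ P ⟶ Y`, a deflation because `q` is one. Maps from `Υ(P)` to an effaceable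
functor vanish because `P` lifts along deflations. This is
`IsExact.exists_conflation_of_hasEnoughProj`.

Conversely, decompose `Υ(A)`. Projectives of the functor category are representable
(`IsExact.exists_iso_yoneda`), so the torsion part is a quotient of some `Υ(Z)`, and orthogonality
to effaceables makes `Z` projective. The composite `Υ(Z) ⟶ Υ(A)` is `Υ(m)`. Its kernel is admissibly
presented, which forces `m` to have a kernel (`exists_isKer_of_smodAdm`); its cokernel is
effaceable, so some deflation onto `A` factors through `m`. The obscure axiom
`IsExact.isDeflation_of_isKer` then makes `m` a deflation. -/

instance additive_preadditiveYoneda :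
    (preadditiveYoneda : C ⥤ Cᵒᵖ ⥤ AddCommGrpCat.{v}).Additive where
  map_add {X Y f g} := by
    ext V (a : V.unop ⟶ X)
    exact Preadditive.comp_add _ _ _ a f g

/-- A morphism from a representable functor with prescribed value at the identity. -/
lemma exists_yoneda_hom {F : Cᵒᵖ ⥤ AddCommGrpCat.{v}} [F.Additive] {W : C} (x : F.obj (op W)) :
    ∃ φ : preadditiveYoneda.obj W ⟶ F, φ.app (op W) (𝟙 W : W ⟶ W) = x := by
  have h₀ (V : C) : F.map (0 : V ⟶ W).op x = 0 := by rw [op_zero, F.map_zero]; rfl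
  have hadd (V : C) (a b : V ⟶ W) : F.map (a + b).op x = F.map a.op x + F.map b.op x := by
    rw [op_add, F.map_add]; rfl
  refine ⟨{
    app := fun V => AddCommGrpCat.ofHom
      { toFun := fun a : V.unop ⟶ W => F.map a.op x
        map_zero' := h₀ _
        map_add' := hadd _ }
    naturality := fun V V' g => ?_ }, ?_⟩
  · ext (a : V.unop ⟶ W)
    change F.map (g.unop ≫ a).op x = F.map g (F.map a.op x)
    rw [op_comp, F.map_comp]
    rfl
  · change F.map (𝟙 W).op x = x
    rw [op_id, F.map_id]
    rfl

lemma yoneda_hom_app {F : Cᵒᵖ ⥤ AddCommGrpCat.{v}} {V W : C}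
    (φ : preadditiveYoneda.obj W ⟶ F) (a : V ⟶ W) :
    φ.app (op V) a = F.map a.op (φ.app (op W) (𝟙 W : W ⟶ W)) := by
  have h := congr($(φ.naturality a.op).hom (𝟙 W : W ⟶ W))
  have h' : φ.app (op V) (a ≫ 𝟙 W) = F.map a.op (φ.app (op W) (𝟙 W : W ⟶ W)) := h
  rwa [Category.comp_id] at h'

lemma yoneda_hom_ext {F : Cᵒᵖ ⥤ AddCommGrpCat.{v}} {W : C}
    {φ ψ : preadditiveYoneda.obj W ⟶ F}
    (h : φ.app (op W) (𝟙 W : W ⟶ W) = ψ.app (op W) (𝟙 W : W ⟶ W)) : φ = ψ := by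
  ext V (a : V.unop ⟶ W)
  exact (yoneda_hom_app φ a).trans ((congrArg _ h).trans (yoneda_hom_app ψ a).symm)

lemma exists_lift_of_epi {F G : Cᵒᵖ ⥤ AddCommGrpCat.{v}} [F.Additive] (p : F ⟶ G) [Epi p]
    {W : C} (x : preadditiveYoneda.obj W ⟶ G) : ∃ y : preadditiveYoneda.obj W ⟶ F, y ≫ p = x := by
  obtain ⟨t, ht⟩ := (AddCommGrpCat.epi_iff_surjective (p.app (op W))).1 inferInstance
    (x.app (op W) (𝟙 W : W ⟶ W))
  obtain ⟨y, hy⟩ := exists_yoneda_hom t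
  refine ⟨y, yoneda_hom_ext ?_⟩
  rw [← ht, ← hy]
  rfl

lemma epi_of_exists_lift {F G : Cᵒᵖ ⥤ AddCommGrpCat.{v}} [G.Additive] (p : F ⟶ G)
    (h : ∀ (W : C) (x : preadditiveYoneda.obj W ⟶ G), ∃ y, y ≫ p = x) : Epi p := by
  have (V : Cᵒᵖ) : Epi (p.app V) := by
    refine (AddCommGrpCat.epi_iff_surjective (p.app V)).2 fun t => ?_
    obtain ⟨x, hx⟩ := exists_yoneda_hom (W := V.unop) t
    obtain ⟨y, rfl⟩ := h _ x
    exact ⟨y.app V (𝟙 V.unop : V.unop ⟶ V.unop), hx⟩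
  exact NatTrans.epi_of_epi_app p

lemma additive_of_mono {F G : Cᵒᵖ ⥤ AddCommGrpCat.{v}} [G.Additive] (p : F ⟶ G) [Mono p] :
    F.Additive :=
  ⟨fun {A B} a b => by
    rw [← cancel_mono (p.app B), p.naturality, Functor.map_add, Preadditive.comp_add,
      Preadditive.add_comp, p.naturality, p.naturality]⟩

lemma exists_lift_of_exact {S : ShortComplex (Cᵒᵖ ⥤ AddCommGrpCat.{v})} [S.X₁.Additive]
    (hS : S.Exact) {W : C} (x : preadditiveYoneda.obj W ⟶ S.X₂) (hx : x ≫ S.g = 0) :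
    ∃ y, y ≫ S.f = x := by
  have := S.exact_iff_epi_kernel_lift.1 hS
  obtain ⟨y, hy⟩ := exists_lift_of_epi (kernel.lift S.g S.f S.zero) (kernel.lift S.g x hx)
  exact ⟨y, by rw [← kernel.lift_ι S.g S.f S.zero, reassoc_of% hy, kernel.lift_ι]⟩

lemma exact_of_exists_lift {S : ShortComplex (Cᵒᵖ ⥤ AddCommGrpCat.{v})} [S.X₂.Additive]
    (h : ∀ (W : C) (x : preadditiveYoneda.obj W ⟶ S.X₂), x ≫ S.g = 0 → ∃ y, y ≫ S.f = x) :
    S.Exact := by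
  rw [S.exact_iff_epi_kernel_lift]
  have := additive_of_mono (kernel.ι S.g)
  refine epi_of_exists_lift _ fun W x => ?_
  obtain ⟨y, hy⟩ := h W (x ≫ kernel.ι S.g) (by simp)
  exact ⟨y, by rw [← cancel_mono (kernel.ι S.g), Category.assoc, kernel.lift_ι, hy]⟩

/-- `π` exhibits `F` as the functor presented by `f`. -/
structure IsPresentation {X Y : C} (f : X ⟶ Y) {F : Cᵒᵖ ⥤ AddCommGrpCat.{v}}
    (π : preadditiveYoneda.obj Y ⟶ F) : Prop where
  epi : Epi π
  map_comp : preadditiveYoneda.map f ≫ π = 0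
  exists_lift : ∀ {W : C} (a : W ⟶ Y), preadditiveYoneda.map a ≫ π = 0 → ∃ b : W ⟶ X, b ≫ f = a

/-- Yoneda turns exactness at `Υ(Y)` into a lifting property inside `C`, the form used from here on.
-/
lemma presents_iff {X Y : C} {f : X ⟶ Y} {F : Cᵒᵖ ⥤ AddCommGrpCat.{v}} :
    Presents f F ↔ ∃ π : preadditiveYoneda.obj Y ⟶ F, IsPresentation f π := by
  constructor
  · rintro ⟨π, w, hex, hπ⟩
    refine ⟨π, hπ, w, fun {W} a ha => ?_⟩
    obtain ⟨y, hy⟩ := exists_lift_of_exact hex _ ha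
    exact ⟨preadditiveYoneda.preimage y, preadditiveYoneda.map_injective (by simpa using hy)⟩
  · rintro ⟨π, h⟩
    refine ⟨π, h.map_comp, exact_of_exists_lift fun W x hx => ?_, h.epi⟩
    obtain ⟨a, rfl⟩ := preadditiveYoneda.map_surjective x
    obtain ⟨b, rfl⟩ := h.exists_lift a hx
    exact ⟨preadditiveYoneda.map b, (preadditiveYoneda.map_comp b f).symm⟩

lemma IsPresentation.surj {X Y : C} {f : X ⟶ Y} {F : Cᵒᵖ ⥤ AddCommGrpCat.{v}}
    {π : preadditiveYoneda.obj Y ⟶ F} (h : IsPresentation f π) {W : C}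
    (x : preadditiveYoneda.obj W ⟶ F) : ∃ a : W ⟶ Y, preadditiveYoneda.map a ≫ π = x := by
  have := h.epi
  obtain ⟨y, rfl⟩ := exists_lift_of_epi π x
  exact ⟨preadditiveYoneda.preimage y, by simp⟩

lemma isPresentation_cokernel {X Y : C} (f : X ⟶ Y) :
    IsPresentation f (cokernel.π (preadditiveYoneda.map f)) := by
  refine ⟨inferInstance, cokernel.condition _, fun {W} a ha => ?_⟩
  obtain ⟨y, hy⟩ := exists_lift_of_exact
    (ShortComplex.exact_cokernel (preadditiveYoneda.map f)) (preadditiveYoneda.map a) ha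
  exact ⟨preadditiveYoneda.preimage y, preadditiveYoneda.map_injective (by simpa using hy)⟩

end Functors

end ConflationStructure
namespace ConflationStructure

/-! ### Exact categories: base change, sums of deflations, the obscure axiom. -/

section Exact

variable {C : Type u} [Category.{v} C] [Preadditive C] {E : ConflationStructure C}

lemma IsDeflation.epi {X Y : C} {p : X ⟶ Y} (h : E.IsDeflation p) : Epi p := by
  obtain ⟨K, i, w, hc⟩ := h
  obtain ⟨hk⟩ := E.isCokernel _ hc
  exact ⟨fun _ _ hab => Cofork.IsColimit.hom_ext hk hab⟩

lemma IsInflation.mono {X Y : C} {i : X ⟶ Y} (h : E.IsInflation i) : Mono i := by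
  obtain ⟨K, p, w, hc⟩ := h
  obtain ⟨hk⟩ := E.isKernel _ hc
  exact ⟨fun _ _ hab => Fork.IsLimit.hom_ext hk hab⟩

/-- A kernel of `p`, in terms of morphisms. -/
structure IsKer {K X Y : C} (k : K ⟶ X) (p : X ⟶ Y) : Prop where
  mono : Mono k
  zero : k ≫ p = 0
  exists_lift : ∀ {W : C} (a : W ⟶ X), a ≫ p = 0 → ∃ b, b ≫ k = a

/-- A cokernel of `i`, in terms of morphisms. -/
structure IsCoker {X Y Z : C} (i : X ⟶ Y) (p : Y ⟶ Z) : Prop where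
  epi : Epi p
  zero : i ≫ p = 0
  exists_desc : ∀ {W : C} (a : Y ⟶ W), i ≫ a = 0 → ∃ b, p ≫ b = a

lemma isKer_of_isConflation {X Y Z : C} {i : X ⟶ Y} {p : Y ⟶ Z} {w : i ≫ p = 0}
    (h : E.IsConflation (ShortComplex.mk i p w)) : IsKer i p := by
  refine ⟨IsInflation.mono ⟨_, _, _, h⟩, w, fun a ha => ?_⟩
  obtain ⟨hk⟩ := E.isKernel _ h
  obtain ⟨l, hl⟩ := KernelFork.IsLimit.lift' hk a ha
  exact ⟨l, hl⟩

lemma isCoker_of_isConflation {X Y Z : C} {i : X ⟶ Y} {p : Y ⟶ Z} {w : i ≫ p = 0}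
    (h : E.IsConflation (ShortComplex.mk i p w)) : IsCoker i p := by
  refine ⟨IsDeflation.epi ⟨_, _, _, h⟩, w, fun a ha => ?_⟩
  obtain ⟨hk⟩ := E.isCokernel _ h
  obtain ⟨l, hl⟩ := CokernelCofork.IsColimit.desc' hk a ha
  exact ⟨l, hl⟩

lemma IsKer.isInflation {K X Y : C} {k : K ⟶ X} {p : X ⟶ Y} (h : IsKer k p)
    (hp : E.IsDeflation p) : E.IsInflation k := by
  obtain ⟨K', k', w, hc⟩ := hp
  have hk' := isKer_of_isConflation hc
  have := h.mono
  have := hk'.mono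
  obtain ⟨s, hs⟩ := h.exists_lift k' hk'.zero
  obtain ⟨t, ht⟩ := hk'.exists_lift k h.zero
  let e : K' ≅ K := ⟨s, t, by simp [← cancel_mono k', ht, hs], by simp [← cancel_mono k, ht, hs]⟩
  have := E.closed_iso
  exact ⟨_, p, h.zero, E.IsConflation.prop_of_iso
    (ShortComplex.isoMk (S₁ := ShortComplex.mk k' p w) (S₂ := ShortComplex.mk k p h.zero)
      e (Iso.refl _) (Iso.refl _) (by simp [e, hs]) (by simp)) hc⟩

lemma IsCoker.isDeflation {X Y Z : C} {i : X ⟶ Y} {p : Y ⟶ Z} (h : IsCoker i p)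
    (hi : E.IsInflation i) : E.IsDeflation p := by
  obtain ⟨Z', p', w, hc⟩ := hi
  have hp' := isCoker_of_isConflation hc
  have := h.epi
  have := hp'.epi
  obtain ⟨s, hs⟩ := h.exists_desc p' hp'.zero
  obtain ⟨t, ht⟩ := hp'.exists_desc p h.zero
  let e : Z' ≅ Z := ⟨t, s, by simp [← cancel_epi p', reassoc_of% ht, hs],
    by simp [← cancel_epi p, reassoc_of% hs, ht]⟩
  have := E.closed_iso
  exact ⟨_, i, h.zero, E.IsConflation.prop_of_iso
    (ShortComplex.isoMk (S₁ := ShortComplex.mk i p' w) (S₂ := ShortComplex.mk i p h.zero)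
      (Iso.refl _) (Iso.refl _) e (by simp) (by simp [e, ht])) hc⟩

lemma IsDeflation.exists_isKer {X Y : C} {p : X ⟶ Y} (h : E.IsDeflation p) :
    ∃ (K : C) (k : K ⟶ X), IsKer k p := by
  obtain ⟨K, k, w, hc⟩ := h
  exact ⟨K, k, isKer_of_isConflation hc⟩

lemma IsInflation.exists_isCoker {X Y : C} {i : X ⟶ Y} (h : E.IsInflation i) :
    ∃ (Z : C) (p : Y ⟶ Z), IsCoker i p ∧ IsKer i p ∧ E.IsDeflation p := by
  obtain ⟨Z, p, w, hc⟩ := h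
  exact ⟨Z, p, isCoker_of_isConflation hc, isKer_of_isConflation hc, ⟨_, _, _, hc⟩⟩

section HasZeroObject

variable [HasZeroObject C]

open ZeroObject

lemma IsExact.isDeflation_of_isIso (hE : E.IsExact) {X Y : C} (p : X ⟶ Y) [IsIso p] :
    E.IsDeflation p :=
  hE.deflation_pullback p (0 : X ⟶ (0 : C)) 0 (𝟙 _) (IsPullback.of_horiz_isIso ⟨by simp⟩)
    (hE.deflation_to_zero (isZero_zero C) _)

lemma IsExact.isAdmissible_of_isInflation (hE : E.IsExact) {X Y : C} {i : X ⟶ Y}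
    (hi : E.IsInflation i) : E.IsAdmissible i :=
  ⟨X, 𝟙 X, i, hE.isDeflation_of_isIso _, hi, Category.id_comp i⟩

end HasZeroObject

/-- The pullback of an admissible morphism along a deflation exists and is admissible. -/
lemma IsExact.exists_isPullback_isAdmissible (hE : E.IsExact) {X Y P : C} {f : X ⟶ Y}
    (hf : E.IsAdmissible f) {q : P ⟶ Y} (hq : E.IsDeflation q) :
    ∃ (X' : C) (f' : X' ⟶ P) (q' : X' ⟶ X), E.IsAdmissible f' ∧ IsPullback q' f' f q := by
  obtain ⟨I, p, i, hp, hi, rfl⟩ := hf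
  have := hE.hasPullback q i hq
  have h₁ := IsPullback.of_hasPullback i q
  have hd := hE.deflation_pullback _ _ _ _ h₁ hq
  have := hE.hasPullback p (pullback.fst i q) hp
  have h₂ := (IsPullback.of_hasPullback (pullback.fst i q) p).flip
  refine ⟨_, _, _, ⟨_, _, _, hE.deflation_pullback _ _ _ _ h₂.flip hp, ?_, rfl⟩,
    h₂.paste_vert h₁⟩
  obtain ⟨Z, c, -, hc, hcd⟩ := hi.exists_isCoker
  have := hc.mono
  -- Pullback stability of inflations is not an axiom; here the base change of `i` along `q` is the
  -- kernel of the composite deflation `q ≫ c`, with `c` the cokernel of `i`.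
  refine IsKer.isInflation (p := q ≫ c) ⟨⟨fun a b hab => h₁.hom_ext ?_ hab⟩, ?_, fun a ha => ?_⟩
    (hE.deflation_comp _ _ hq hcd)
  · rw [← cancel_mono i, Category.assoc, Category.assoc, h₁.w, reassoc_of% hab]
  · rw [← reassoc_of% h₁.w, hc.zero, comp_zero]
  · obtain ⟨b, hb⟩ := hc.exists_lift (a ≫ q) (by simpa using ha)
    exact ⟨h₁.lift b a hb, h₁.lift_snd _ _ _⟩

variable [HasZeroObject C] [HasBinaryBiproducts C]

lemma IsExact.isDeflation_biprod_snd (hE : E.IsExact) (X Y : C) :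
    E.IsDeflation (biprod.snd : X ⊞ Y ⟶ Y) :=
  hE.deflation_pullback _ _ _ _ (IsPullback.of_has_biproduct X Y).flip
    (hE.deflation_to_zero (isZero_zero C) _)

/-- The map factors as `𝟙 ⊞ q` (a pullback of `q`), a shear automorphism of `X ⊞ Y`, and the
projection to `Y`. -/
lemma IsExact.isDeflation_biprod_desc (hE : E.IsExact) {X P Y : C} (f : X ⟶ Y) {q : P ⟶ Y}
    (hq : E.IsDeflation q) : E.IsDeflation (biprod.desc f q) := by
  have h₁ : E.IsDeflation (biprod.map (𝟙 X) q) := by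
    refine hE.deflation_pullback _ (biprod.snd : X ⊞ P ⟶ P) (biprod.snd : X ⊞ Y ⟶ Y) q
      (IsPullback.of_isLimit' ⟨by simp⟩ (PullbackCone.IsLimit.mk _
        (fun s => biprod.lift (s.fst ≫ biprod.fst) s.snd) (fun s => ?_) (fun s => ?_)
        fun s m h₁ h₂ => ?_)) hq
    · ext
      · simp
      · simpa using s.condition.symm
    · simp
    · ext
      · simp [← h₁]
      · simpa using h₂
  have h₂ : biprod.desc f q = biprod.map (𝟙 X) q ≫ (biprod.lift biprod.fst
      (biprod.desc f (𝟙 Y)) : X ⊞ Y ⟶ X ⊞ Y) ≫ biprod.snd := by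
    ext <;> simp
  have : IsIso (biprod.lift biprod.fst (biprod.desc f (𝟙 Y)) : X ⊞ Y ⟶ X ⊞ Y) :=
    ⟨biprod.lift biprod.fst (biprod.desc (-f) (𝟙 Y)), by ext <;> simp, by ext <;> simp⟩
  rw [h₂]
  exact hE.deflation_comp _ _ h₁
    (hE.deflation_comp _ _ (hE.isDeflation_of_isIso _) (hE.isDeflation_biprod_snd X Y))

/-- The obscure axiom: a morphism with a kernel through which a deflation factors is a
deflation. -/
lemma IsExact.isDeflation_of_isKer (hE : E.IsExact) {K Z A B : C} {k : K ⟶ Z} {m : Z ⟶ A}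
    (hk : IsKer k m) (l : B ⟶ Z) (hl : E.IsDeflation (l ≫ m)) : E.IsDeflation m := by
  have := hk.mono
  -- A shear of `Z ⊞ B` carries `(m, l ≫ m)` to `(m, 0)`.
  have hφ : E.IsDeflation (biprod.desc m (0 : B ⟶ A)) := by
    have h : biprod.desc m (0 : B ⟶ A) =
        (biprod.lift (biprod.desc (𝟙 Z) (-l)) biprod.snd : Z ⊞ B ⟶ Z ⊞ B) ≫
          biprod.desc m (l ≫ m) := by
      ext <;> simp
    have : IsIso (biprod.lift (biprod.desc (𝟙 Z) (-l)) biprod.snd : Z ⊞ B ⟶ Z ⊞ B) :=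
      ⟨biprod.lift (biprod.desc (𝟙 Z) l) biprod.snd, by ext <;> simp, by ext <;> simp⟩
    rw [h]
    exact hE.deflation_comp _ _ (hE.isDeflation_of_isIso _) (hE.isDeflation_biprod_desc m hl)
  obtain ⟨N, ι, w, hc⟩ := hφ
  have hι := isKer_of_isConflation hc
  have hφ' := isCoker_of_isConflation hc
  have := hι.mono
  have := hφ'.epi
  have hfst : biprod.desc m (0 : B ⟶ A) = biprod.fst ≫ m := by ext <;> simp
  rw [hfst] at hι hφ'
  obtain ⟨f, hf⟩ := hk.exists_lift (ι ≫ biprod.fst) (by simpa using hι.zero)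
  obtain ⟨j, hj⟩ := hι.exists_lift biprod.inr (by simp)
  obtain ⟨n, hn⟩ := hι.exists_lift (k ≫ biprod.inl) (by simp [hk.zero])
  have hjf : j ≫ f = 0 := by simp [← cancel_mono k, hf, reassoc_of% hj]
  have hnf : n ≫ f = 𝟙 K := by simp [← cancel_mono k, hf, reassoc_of% hn]
  -- The kernel `N` of `(m, 0)` is morally `K ⊞ B`, with `f` the projection to `K`; pushing `ι` out
  -- along `f` kills `B` and leaves `k`, which is therefore an inflation.
  have hpo : IsPushout f ι k biprod.fst := by
    refine IsPushout.of_isColimit' ⟨hf⟩ (PushoutCocone.IsColimit.mk _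
      (fun s => biprod.inl ≫ s.inr) (fun s => ?_) (fun s => ?_) fun s t _ h₂ => ?_)
    · rw [← Category.assoc, ← hn, Category.assoc, ← s.condition, reassoc_of% hnf]
    · ext
      · simp
      · simp only [biprod.inr_fst_assoc, zero_comp]
        rw [← hj, Category.assoc, ← s.condition, reassoc_of% hjf, zero_comp]
    · simp [← h₂]
  have hm : IsCoker k m := by
    have := hφ'.epi
    refine ⟨epi_of_epi (biprod.fst : Z ⊞ B ⟶ Z) m, hk.zero, fun a ha => ?_⟩
    obtain ⟨b, hb⟩ := hφ'.exists_desc (biprod.fst ≫ a) (by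
      rw [← Category.assoc, ← hf, Category.assoc, ha, comp_zero])
    exact ⟨b, by rw [← cancel_epi (biprod.fst : Z ⊞ B ⟶ Z), ← hb, Category.assoc]⟩
  exact hm.isDeflation (hE.inflation_pushout _ _ _ _ hpo ⟨_, _, _, hc⟩)

end Exact

end ConflationStructure
namespace ConflationStructure

/-! ### Admissibly presented functors and their projectives. -/

section SmodAdm

variable {C : Type u} [Category.{v} C] [Preadditive C] {E : ConflationStructure C}

lemma additive_of_smodAdm {F : Cᵒᵖ ⥤ AddCommGrpCat.{v}} (h : E.smodAdm F) : F.Additive := by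
  obtain ⟨_, _, _, _, h⟩ := h
  exact h.additive

lemma IsPresentation.smodAdm {X Y : C} {f : X ⟶ Y} {F : Cᵒᵖ ⥤ AddCommGrpCat.{v}}
    {π : preadditiveYoneda.obj Y ⟶ F} (h : IsPresentation f π) (hf : E.IsAdmissible f) :
    E.smodAdm F :=
  ⟨_, _, f, hf, presents_iff.2 ⟨π, h⟩⟩

lemma IsPresentation.eff {X Y : C} {f : X ⟶ Y} {F : Cᵒᵖ ⥤ AddCommGrpCat.{v}}
    {π : preadditiveYoneda.obj Y ⟶ F} (h : IsPresentation f π) (hf : E.IsDeflation f) :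
    E.eff F :=
  ⟨_, _, f, hf, presents_iff.2 ⟨π, h⟩⟩

lemma IsPresentation.comp_iso {X Y : C} {f : X ⟶ Y} {F G : Cᵒᵖ ⥤ AddCommGrpCat.{v}}
    {π : preadditiveYoneda.obj Y ⟶ F} (h : IsPresentation f π) (e : F ≅ G) :
    IsPresentation f (π ≫ e.hom) := by
  have := h.epi
  refine ⟨inferInstance, by rw [reassoc_of% h.map_comp, zero_comp], fun a ha =>
    h.exists_lift a ?_⟩
  rwa [← Category.assoc, Preadditive.IsIso.comp_right_eq_zero] at ha

lemma isDeflation_of_epi {F G : E.SmodAdm} (p : F ⟶ G) (hp : Epi p.hom)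
    (hk : E.smodAdm (kernel p.hom)) : E.smodAdmConflation.IsDeflation p :=
  ⟨⟨kernel p.hom, hk⟩, ObjectProperty.homMk (kernel.ι p.hom),
    ObjectProperty.hom_ext _ (kernel.condition p.hom),
    { exact := ShortComplex.exact_kernel p.hom
      mono_f := inferInstanceAs (Mono (kernel.ι p.hom))
      epi_g := hp }⟩

lemma epi_hom_of_isDeflation {F G : E.SmodAdm} {p : F ⟶ G}
    (hp : E.smodAdmConflation.IsDeflation p) : Epi p.hom := by
  obtain ⟨_, _, _, h⟩ := hp
  exact ShortComplex.ShortExact.epi_g h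

lemma effAdm_isClosedUnderIsomorphisms : E.effAdm.IsClosedUnderIsomorphisms := by
  refine ⟨fun {F G} e h => ?_⟩
  obtain ⟨X, Y, f, hf, h⟩ := h
  obtain ⟨π, h⟩ := presents_iff.1 h
  exact (h.comp_iso (E.smodAdm.ι.mapIso e)).eff hf

lemma gen_isClosedUnderIsomorphisms (𝒳 : ObjectProperty E.SmodAdm) :
    (E.smodAdmConflation.gen 𝒳).IsClosedUnderIsomorphisms := by
  refine ⟨fun {F G} e h => ?_⟩
  obtain ⟨X, p, hX, K, i, w, hc⟩ := h
  have := E.smodAdmConflation.closed_iso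
  exact ⟨X, p ≫ e.hom, hX, K, i, by rw [reassoc_of% w, zero_comp],
    E.smodAdmConflation.IsConflation.prop_of_iso (ShortComplex.isoMk
      (S₁ := ShortComplex.mk i p w)
      (S₂ := ShortComplex.mk i (p ≫ e.hom) (by rw [reassoc_of% w, zero_comp]))
      (Iso.refl _) (Iso.refl _) e (by simp) (by simp)) hc⟩

lemma hom_eq_zero_of_gen {𝒳 : ObjectProperty E.SmodAdm} {T F : E.SmodAdm}
    (hT : E.smodAdmConflation.gen (𝒳 ⊓ E.effAdm.leftOrthogonal) T) (hF : E.effAdm F)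
    (f : T ⟶ F) : f = 0 := by
  obtain ⟨X, p, hX, hp⟩ := hT
  have := hp.epi
  rw [← cancel_epi p, comp_zero]
  exact hX.2 _ hF

/-- If the kernel of `Υ(m)` is admissibly presented, then `m` has a kernel. -/
lemma exists_isKer_of_smodAdm {Z A : C} (m : Z ⟶ A) {F : Cᵒᵖ ⥤ AddCommGrpCat.{v}}
    (hF : E.smodAdm F) (j : F ⟶ preadditiveYoneda.obj Z) [Mono j]
    (hj : j ≫ preadditiveYoneda.map m = 0)
    (hlift : ∀ {W : C} (a : W ⟶ Z), a ≫ m = 0 → ∃ x, x ≫ j = preadditiveYoneda.map a) :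
    ∃ (K : C) (k : K ⟶ Z), IsKer k m := by
  obtain ⟨X, Y, f, ⟨I, p, i, hp, hi, rfl⟩, h⟩ := hF
  obtain ⟨π, h⟩ := presents_iff.1 h
  -- The cokernel of the inflation part is the candidate: the map `y : Y ⟶ Z` inducing `π ≫ j`
  -- factors as `c ≫ k`.
  obtain ⟨K, c, hc, -, -⟩ := hi.exists_isCoker
  have := hc.epi
  have := hp.epi
  obtain ⟨y, hy⟩ := preadditiveYoneda.map_surjective (π ≫ j)
  have hker {W : C} (a : W ⟶ Y) (ha : a ≫ y = 0) : a ≫ c = 0 := by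
    obtain ⟨b, rfl⟩ := h.exists_lift a (by
      rw [← cancel_mono j, Category.assoc, ← hy, ← Functor.map_comp, ha, Functor.map_zero,
        zero_comp])
    simp [hc.zero]
  have hiy : i ≫ y = 0 := by
    rw [← cancel_epi p, ← Category.assoc, comp_zero]
    apply preadditiveYoneda.map_injective
    rw [Functor.map_comp, hy, reassoc_of% h.map_comp, zero_comp, Functor.map_zero]
  have hym : y ≫ m = 0 := preadditiveYoneda.map_injective (by
    rw [Functor.map_comp, hy, Category.assoc, hj, comp_zero, Functor.map_zero])
  obtain ⟨k, hk⟩ := hc.exists_desc y hiy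
  have hkm : k ≫ m = 0 := by rw [← cancel_epi c, reassoc_of% hk, hym, comp_zero]
  have hlift' {W : C} (a : W ⟶ Z) (ha : a ≫ m = 0) : ∃ b : W ⟶ Y, b ≫ y = a := by
    obtain ⟨x, hx⟩ := hlift a ha
    obtain ⟨b, rfl⟩ := h.surj x
    refine ⟨b, preadditiveYoneda.map_injective ?_⟩
    rw [Functor.map_comp, hy, ← hx, Category.assoc]
  -- Since `m` kills `k`, it lifts through `y`; the lift `r` is a section of `c`, which makes `k`
  -- monic.
  obtain ⟨r, hr⟩ := hlift' k hkm
  have hrc : r ≫ c = 𝟙 K := by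
    have := hker (c ≫ r - 𝟙 Y) (by simp [hr, hk])
    rw [← cancel_epi c, ← sub_eq_zero]
    simpa using this
  refine ⟨K, k, Preadditive.mono_of_cancel_zero _ fun a ha => ?_, hkm, fun a ha => ?_⟩
  · have := hker (a ≫ r) (by rw [Category.assoc, hr, ha])
    rwa [Category.assoc, hrc, Category.comp_id] at this
  · obtain ⟨b, hb⟩ := hlift' a ha
    exact ⟨b ≫ c, by rw [Category.assoc, hk, hb]⟩

variable [HasZeroObject C]

/-- The kernel of `π` is the image of `Υ(p ≫ i)`. As `i` is monic, its relations are the kernel of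
the deflation `p`, an inflation and hence admissible. This makes `π` a deflation of the functor
category. -/
lemma IsExact.smodAdm_kernel (hE : E.IsExact) {X Y : C} {f : X ⟶ Y}
    {F : Cᵒᵖ ⥤ AddCommGrpCat.{v}} {π : preadditiveYoneda.obj Y ⟶ F} (h : IsPresentation f π)
    (hf : E.IsAdmissible f) : E.smodAdm (kernel π) := by
  obtain ⟨I, p, i, hp, hi, rfl⟩ := hf
  obtain ⟨K, k, hk⟩ := hp.exists_isKer
  have := hi.mono
  have := additive_of_mono (kernel.ι π)
  refine IsPresentation.smodAdm (f := k)
    (π := kernel.lift π (preadditiveYoneda.map (p ≫ i)) h.map_comp) ⟨?_, ?_, fun a ha => ?_⟩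
    (hE.isAdmissible_of_isInflation (hk.isInflation hp))
  · refine epi_of_exists_lift _ fun W x => ?_
    obtain ⟨a, ha⟩ := preadditiveYoneda.map_surjective (x ≫ kernel.ι π)
    obtain ⟨b, hb⟩ := h.exists_lift a (by simp [ha])
    refine ⟨preadditiveYoneda.map b, ?_⟩
    rw [← cancel_mono (kernel.ι π), Category.assoc, kernel.lift_ι, ← Functor.map_comp, hb, ha]
  · rw [← cancel_mono (kernel.ι π), Category.assoc, kernel.lift_ι, ← Functor.map_comp,
      reassoc_of% hk.zero, zero_comp, Functor.map_zero, zero_comp]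
  · have ha' := congr($ha ≫ kernel.ι π)
    rw [Category.assoc, kernel.lift_ι, ← Functor.map_comp, zero_comp,
      Functor.map_eq_zero_iff, ← Category.assoc] at ha'
    exact hk.exists_lift a (by rw [← cancel_mono i, ha', zero_comp])

lemma IsExact.smodAdm_yoneda (hE : E.IsExact) (A : C) :
    E.smodAdm (preadditiveYoneda.obj A) := by
  obtain ⟨Z, hZ⟩ := HasZeroObject.zero (C := C)
  refine IsPresentation.smodAdm (f := (0 : Z ⟶ A)) (π := 𝟙 _)
    ⟨inferInstance, by simp, fun a ha => ⟨0, ?_⟩⟩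
    (hE.isAdmissible_of_isInflation (hE.inflation_from_zero hZ _))
  rw [Category.comp_id, Functor.map_eq_zero_iff] at ha
  rw [ha, comp_zero]

/-- The representable functors as admissibly presented functors. -/
abbrev IsExact.yonedaAdm (hE : E.IsExact) (A : C) : E.SmodAdm :=
  ⟨preadditiveYoneda.obj A, hE.smodAdm_yoneda A⟩

lemma IsExact.proj_yonedaAdm (hE : E.IsExact) (A : C) :
    E.smodAdmConflation.proj (hE.yonedaAdm A) := by
  intro X Y p hp f
  have := epi_hom_of_isDeflation hp
  have := additive_of_smodAdm X.property
  obtain ⟨y, hy⟩ := exists_lift_of_epi p.hom f.hom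
  exact ⟨ObjectProperty.homMk y, ObjectProperty.hom_ext _ hy⟩

lemma IsExact.leftOrthogonal_yonedaAdm (hE : E.IsExact) {A : C} (hA : E.proj A) :
    E.effAdm.leftOrthogonal (hE.yonedaAdm A) := by
  intro F f hF
  obtain ⟨X, Y, g, hg, h⟩ := hF
  obtain ⟨π, h⟩ := presents_iff.1 h
  obtain ⟨a, ha⟩ := h.surj f.hom
  obtain ⟨b, rfl⟩ := hA g hg a
  refine ObjectProperty.hom_ext _ (ha.symm.trans ?_)
  rw [Functor.map_comp, Category.assoc, h.map_comp, comp_zero]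
  rfl

/-- A projective admissibly presented functor is representable. -/
lemma IsExact.exists_iso_yoneda (hE : E.IsExact) {P : E.SmodAdm}
    (hP : E.smodAdmConflation.proj P) : ∃ Z : C, Nonempty (P ≅ hE.yonedaAdm Z) := by
  obtain ⟨X, Y, f, hf, h⟩ := P.property
  obtain ⟨π, h⟩ := presents_iff.1 h
  let q : hE.yonedaAdm Y ⟶ P := ObjectProperty.homMk π
  obtain ⟨s', hs'⟩ := hP q (isDeflation_of_epi q h.epi (hE.smodAdm_kernel h hf)) (𝟙 P)
  obtain ⟨s, rfl⟩ := ObjectProperty.homMk_surjective s'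
  have hs : s ≫ π = 𝟙 P.obj := congr($(hs').hom)
  obtain ⟨I, p, i, hp, hi, rfl⟩ := hf
  obtain ⟨Z, c, hc, -, -⟩ := hi.exists_isCoker
  have := hc.epi
  have := hp.epi
  -- The idempotent `e` cuts `P` out of `Υ(Y)`. It kills `i` and is `𝟙 Y` modulo maps through `i`,
  -- so it splits through the cokernel `c` of `i`; no idempotent completeness is needed.
  obtain ⟨e, he⟩ := preadditiveYoneda.map_surjective (π ≫ s)
  obtain ⟨t, ht⟩ := h.exists_lift (𝟙 Y - e) (by
    rw [Functor.map_sub, Preadditive.sub_comp, he, Category.assoc, hs]; simp)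
  have hie : i ≫ e = 0 := by
    rw [← cancel_epi p, ← Category.assoc, comp_zero]
    apply preadditiveYoneda.map_injective
    rw [Functor.map_comp, he, reassoc_of% h.map_comp, zero_comp, Functor.map_zero]
  obtain ⟨r, hr⟩ := hc.exists_desc e hie
  have hec : e ≫ c = c := by
    have : e = 𝟙 Y - t ≫ p ≫ i := by rw [ht]; abel
    rw [this]
    simp [hc.zero]
  have hrc : r ≫ c = 𝟙 Z := by
    rw [← cancel_epi c, reassoc_of% hr, hec, Category.comp_id]
  refine ⟨Z, ⟨ObjectProperty.isoMk _ ⟨s ≫ preadditiveYoneda.map c, preadditiveYoneda.map r ≫ π,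
    ?_, ?_⟩⟩⟩
  · rw [Category.assoc, ← Functor.map_comp_assoc, hr, he, Category.assoc, hs, Category.comp_id, hs]
  · rw [Category.assoc, ← Category.assoc π, ← he, ← Functor.map_comp, ← Functor.map_comp, hec, hrc]
    exact preadditiveYoneda.map_id Z

/-- The obstruction to lifting `f` along a deflation `g` is a map from `Υ(Z)` to the effaceable
functor `coker Υ(g)`. -/
lemma IsExact.proj_of_leftOrthogonal (hE : E.IsExact) {Z : C}
    (hZ : E.effAdm.leftOrthogonal (hE.yonedaAdm Z)) : E.proj Z := by
  intro X Y g hg f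
  have h := isPresentation_cokernel g
  let F : E.SmodAdm := ⟨_, hE.eff_le_smodAdm _ (h.eff hg)⟩
  have h0 := hZ (Y := F) (ObjectProperty.homMk (preadditiveYoneda.map f ≫ cokernel.π _)) (h.eff hg)
  exact h.exists_lift f congr($(h0).hom)

/-! ### The two main implications. -/

variable [HasBinaryBiproducts C]

lemma IsExact.exists_conflation_of_hasEnoughProj (hE : E.IsExact) (hP : E.HasEnoughProj)
    (M : E.SmodAdm) :
    ∃ (T F : E.SmodAdm) (i : T ⟶ M) (p : M ⟶ F) (w : i ≫ p = 0),
      E.smodAdmConflation.gen (E.smodAdmConflation.proj ⊓ E.effAdm.leftOrthogonal) T ∧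
        E.effAdm F ∧ E.smodAdmConflation.IsConflation (ShortComplex.mk i p w) := by
  obtain ⟨X, Y, f, hf, h⟩ := M.property
  obtain ⟨π, h⟩ := presents_iff.1 h
  obtain ⟨P, q, hPproj, hq⟩ := hP Y
  obtain ⟨X', f', q', hf', hpb⟩ := hE.exists_isPullback_isAdmissible hf hq
  have := h.epi
  let φ := preadditiveYoneda.map q ≫ π
  have hF : IsPresentation (biprod.desc f q) (π ≫ cokernel.π φ) := by
    refine ⟨inferInstance, ?_, fun a ha => ?_⟩
    · have : biprod.desc f q = biprod.fst ≫ f + biprod.snd ≫ q := by ext <;> simp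
      rw [this, Functor.map_add, Preadditive.add_comp, Functor.map_comp, Functor.map_comp,
        Category.assoc, reassoc_of% h.map_comp, Category.assoc, ← Category.assoc _ π,
        cokernel.condition]
      simp
    · obtain ⟨y, hy⟩ := exists_lift_of_exact (ShortComplex.exact_cokernel φ)
        (preadditiveYoneda.map a ≫ π) (by simpa using ha)
      obtain ⟨b, rfl⟩ := preadditiveYoneda.map_surjective y
      obtain ⟨d, hd⟩ := h.exists_lift (a - b ≫ q) (by
        simpa [φ, Functor.map_sub, Preadditive.sub_comp, sub_eq_zero] using hy.symm)
      exact ⟨biprod.lift d b, by simp [hd]⟩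
  -- A map `a` into `P` dies in the image exactly when `a ≫ q` factors through `f`, that is, when
  -- `a` factors through the pullback `f'`.
  have hT : IsPresentation f' (Abelian.factorThruImage φ) := by
    have hι : Abelian.factorThruImage φ ≫ Abelian.image.ι φ = preadditiveYoneda.map q ≫ π :=
      Abelian.image.fac φ
    refine ⟨inferInstance, ?_, fun a ha => ?_⟩
    · rw [← cancel_mono (Abelian.image.ι φ), Category.assoc, hι, ← Functor.map_comp_assoc,
        ← hpb.w, Functor.map_comp_assoc, h.map_comp, comp_zero, zero_comp]
    · obtain ⟨b, hb⟩ := h.exists_lift (a ≫ q) (by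
        rw [Functor.map_comp_assoc, ← hι, reassoc_of% ha, zero_comp])
      exact ⟨hpb.lift b a hb, hpb.lift_snd _ _ _⟩
  have hFd := hE.isDeflation_biprod_desc f hq
  let T : E.SmodAdm := ⟨_, hT.smodAdm hf'⟩
  let F : E.SmodAdm := ⟨_, hE.eff_le_smodAdm _ (hF.eff hFd)⟩
  refine ⟨T, F, ObjectProperty.homMk (Abelian.image.ι φ), ObjectProperty.homMk (cokernel.π φ),
    ObjectProperty.hom_ext _ (kernel.condition _), ⟨hE.yonedaAdm P,
      ObjectProperty.homMk (Abelian.factorThruImage φ), ⟨hE.proj_yonedaAdm P,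
        hE.leftOrthogonal_yonedaAdm hPproj⟩,
      isDeflation_of_epi _ hT.epi (hE.smodAdm_kernel hT hf')⟩, hF.eff hFd,
    { exact := ShortComplex.exact_kernel (cokernel.π φ)
      mono_f := inferInstanceAs (Mono (kernel.ι (cokernel.π φ)))
      epi_g := inferInstanceAs (Epi (cokernel.π φ)) }⟩

lemma IsExact.hasEnoughProj_of_exists_conflation (hE : E.IsExact)
    (H : ∀ P : E.SmodAdm, E.smodAdmConflation.proj P →
      ∃ (F' F'' : E.SmodAdm) (i : F' ⟶ P) (p : P ⟶ F'') (w : i ≫ p = 0),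
        E.smodAdmConflation.gen (E.smodAdmConflation.proj ⊓ E.effAdm.leftOrthogonal) F' ∧
          E.effAdm F'' ∧ E.smodAdmConflation.IsConflation (ShortComplex.mk i p w)) :
    E.HasEnoughProj := by
  intro A
  obtain ⟨F', F'', i, p, w, ⟨P, r, ⟨hP, hP'⟩, hr⟩, ⟨B, D, g, hg, hF⟩, hc⟩ :=
    H _ (hE.proj_yonedaAdm A)
  have hc : (ShortComplex.mk i.hom p.hom congr($(w).hom)).ShortExact := hc
  have : Mono i.hom := hc.mono_f
  obtain ⟨π, hF⟩ := presents_iff.1 hF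
  obtain ⟨Z, ⟨e⟩⟩ := hE.exists_iso_yoneda hP
  have hZ : E.proj Z := hE.proj_of_leftOrthogonal (E.effAdm.leftOrthogonal.prop_of_iso e hP')
  obtain ⟨K₀, j, wj, hr⟩ := hr
  have hr : (ShortComplex.mk j.hom r.hom congr($(wj).hom)).ShortExact := hr
  have : Mono j.hom := hr.mono_f
  have : Epi r.hom := hr.epi_g
  have := additive_of_smodAdm F'.property
  have := additive_of_smodAdm P.property
  have := additive_of_smodAdm K₀.property
  obtain ⟨m, hm⟩ := preadditiveYoneda.map_surjective (e.inv.hom ≫ r.hom ≫ i.hom)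
  have hm' : e.hom.hom ≫ preadditiveYoneda.map m = r.hom ≫ i.hom := by
    rw [hm, ObjectProperty.isoHom_inv_id_hom_assoc]
  obtain ⟨u, hu⟩ := hF.surj p.hom
  have := hE.hasPullback g u hg
  have hpb := IsPullback.of_hasPullback u g
  have hg' := hE.deflation_pullback _ _ _ _ hpb hg
  -- The pullback of `g` along `u` becomes zero in `F''`, so it comes from `F'` and then lifts to
  -- `Υ(Z)`.
  obtain ⟨l, hl⟩ : ∃ l, l ≫ m = pullback.fst u g := by
    obtain ⟨x, hx⟩ := exists_lift_of_exact hc.exact (preadditiveYoneda.map (pullback.fst u g)) (by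
      change _ ≫ p.hom = 0
      rw [← hu, ← Functor.map_comp_assoc, hpb.w, Functor.map_comp_assoc, hF.map_comp, comp_zero])
    obtain ⟨y, rfl⟩ := exists_lift_of_epi r.hom x
    obtain ⟨l, hl⟩ := preadditiveYoneda.map_surjective (y ≫ e.hom.hom)
    refine ⟨l, preadditiveYoneda.map_injective ?_⟩
    rw [Functor.map_comp, hl, Category.assoc, hm', ← hx, Category.assoc]
  -- As `i` is monic, the kernel of `Υ(m)` is that of the deflation `r`, which is admissibly
  -- presented.
  obtain ⟨K, k, hk⟩ := exists_isKer_of_smodAdm m K₀.property (j.hom ≫ e.hom.hom)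
    (by
      have : j.hom ≫ r.hom = 0 := congr($(wj).hom)
      rw [Category.assoc, hm', reassoc_of% this, zero_comp])
    (fun a ha => by
      obtain ⟨x, hx⟩ := exists_lift_of_exact hr.exact (preadditiveYoneda.map a ≫ e.inv.hom) (by
        dsimp
        rw [← cancel_mono i.hom, zero_comp, Category.assoc, Category.assoc, ← hm,
          ← Functor.map_comp, ha, Functor.map_zero])
      refine ⟨x, ?_⟩
      dsimp at hx
      rw [reassoc_of% hx, ObjectProperty.isoInv_hom_id_hom, Category.comp_id])
  exact ⟨Z, m, hZ, hE.isDeflation_of_isKer hk l (hl ▸ hg')⟩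

end SmodAdm

end ConflationStructure

theorem mainTheorem10 {C : Type u} [Category.{v} C] [Preadditive C] [HasFiniteBiproducts C]
    (E : ConflationStructure C) (hE : E.IsExact) :
    List.TFAE
      [E.HasEnoughProj,
       E.smodAdmConflation.IsTorsionPair
         (E.smodAdmConflation.gen (E.smodAdmConflation.proj ⊓ E.effAdm.leftOrthogonal)) E.effAdm,
       ∀ P : E.SmodAdm, E.smodAdmConflation.proj P →
         ∃ (F' F'' : E.SmodAdm) (i : F' ⟶ P) (p : P ⟶ F'') (w : i ≫ p = 0),
           E.smodAdmConflation.gen (E.smodAdmConflation.proj ⊓ E.effAdm.leftOrthogonal) F' ∧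
           E.effAdm F'' ∧ E.smodAdmConflation.IsConflation (ShortComplex.mk i p w)] := by
  have := hasZeroObject_of_hasFiniteBiproducts C
  have := hasBinaryBiproducts_of_finite_biproducts C
  tfae_have 1 → 2 := fun h =>
    { closed_iso_left := ConflationStructure.gen_isClosedUnderIsomorphisms _
      closed_iso_right := ConflationStructure.effAdm_isClosedUnderIsomorphisms
      hom_eq_zero := ConflationStructure.hom_eq_zero_of_gen
      exists_conflation := hE.exists_conflation_of_hasEnoughProj h }
  tfae_have 2 → 3 := fun h P _ => h.exists_conflation P
  tfae_have 3 → 1 := hE.hasEnoughProj_of_exists_conflation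
  tfae_finish
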